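/- Let $G$ be a finite simple graph with vertex set $V(G)$, let $d(v)$ denote the degree of a vertex $v$ in $G$, and let $\alpha(G)$ denote the independence number of $G$, that is, the maximum number of pairwise non-adjacent vertices of $G$. Let $f : V(G) \to \mathbb{R}$ be a function such that $$f(v) \le \frac{1}{d(v) + 1/2} \quad \text{for every } v \in V(G),$$ and such that $\sum_{v \in K} f(v) \le 1$ for every clique $K \subseteq V(G)$ (a set of pairwise adjacent vertices). Then $$\alpha(G) \ge \sum_{v \in V(G)} f(v).$$ -/

import Mathlib

/-! Induct on the vertex set `W`, with degrees taken inside `W`. If `u` is simplicial, its closed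
neighbourhood `N` weighs at most 1: delete `N` and add `u` to the independent set.

Without simplicial vertices, every vertex of a clique `Q` has degree at least `|Q|`, so the weights
`1 / (d + 1/2)` satisfy the clique condition by themselves and may replace `f`. Let `x` have maximum
degree `D`. Deleting `x` does not lower the total weight, so induction applies unless the deletion
makes some `u` simplicial. Then `u` is adjacent to `x` and to some `y` not adjacent to `x`. Replace
`N` by the single vertex obtained by merging `y` into `x`, with weight `1 / (2D + 1)`. The weight
drops by at most 1, and an independent set gains a vertex on the way back: `y` if it contains `x`,
else `u`. -/

namespace SimpleGraph

section

open scoped Classical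

variable {V : Type*} {G : SimpleGraph V}

/-- The neighbours of `v` inside the vertex set `W`. -/
noncomputable def nbrIn (G : SimpleGraph V) (W : Finset V) (v : V) : Finset V :=
  W.filter (G.Adj v)

/-- The weight `1 / (d + 1 / 2)`, where `d` is the degree of `v` inside `W`. -/
noncomputable def halfWeight (G : SimpleGraph V) (W : Finset V) (v : V) : ℝ :=
  1 / (((G.nbrIn W v).card : ℝ) + 1 / 2)

/-- `v` is simplicial in `W` if its closed neighbourhood inside `W` is a clique. -/
def IsSimplicialIn (G : SimpleGraph V) (W : Finset V) (v : V) : Prop :=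
  G.IsClique (insert v (G.nbrIn W v) : Finset V)

/-- Merge the vertex `y` into `x`: the vertex `x` becomes adjacent to all neighbours of `y`. -/
def fold (G : SimpleGraph V) (x y : V) : SimpleGraph V where
  Adj a b := a ≠ b ∧ (G.Adj a b ∨ (a = x ∧ G.Adj y b) ∨ (b = x ∧ G.Adj y a))
  symm := ⟨fun _ _ h => ⟨h.1.symm, h.2.imp (fun h => h.symm) Or.symm⟩⟩
  loopless := ⟨fun _ h => h.1 rfl⟩

@[simp]
theorem mem_nbrIn {W : Finset V} {v w : V} : w ∈ G.nbrIn W v ↔ w ∈ W ∧ G.Adj v w := by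
  simp [nbrIn]

theorem nbrIn_mono {S W : Finset V} (h : S ⊆ W) (v : V) : G.nbrIn S v ⊆ G.nbrIn W v :=
  Finset.filter_subset_filter _ h

theorem insert_nbrIn_subset {W : Finset V} {v : V} (hv : v ∈ W) : insert v (G.nbrIn W v) ⊆ W :=
  Finset.insert_subset hv (Finset.filter_subset _ _)

theorem card_insert_nbrIn (W : Finset V) (v : V) :
    (insert v (G.nbrIn W v)).card = (G.nbrIn W v).card + 1 :=
  Finset.card_insert_of_notMem (by simp)

theorem halfWeight_anti {S W : Finset V} (h : S ⊆ W) (v : V) :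
    G.halfWeight W v ≤ G.halfWeight S v := by
  have : ((G.nbrIn S v).card : ℝ) ≤ (G.nbrIn W v).card := by
    exact_mod_cast Finset.card_le_card (nbrIn_mono h v)
  exact one_div_le_one_div_of_le (by positivity) (by linarith)

/-- An independent set outside the closed neighbourhood of `v` can be extended by `v`. -/
theorem exists_isIndepSet_insert {W : Finset V} {v : V} (hv : v ∈ W) {I : Finset V}
    (hIW : I ⊆ W \ insert v (G.nbrIn W v)) (hI : G.IsIndepSet (I : Set V)) :
    ∃ J ⊆ W, G.IsIndepSet (J : Set V) ∧ J.card = I.card + 1 := by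
  have hout : ∀ x ∈ I, x ∈ W ∧ x ≠ v ∧ ¬ G.Adj v x := by
    intro x hx
    have := hIW hx
    simp only [Finset.mem_sdiff, Finset.mem_insert, mem_nbrIn, not_or] at this
    exact ⟨this.1, this.2.1, fun h => this.2.2 ⟨this.1, h⟩⟩
  refine ⟨insert v I, Finset.insert_subset hv fun x hx => (hout x hx).1, ?_,
    Finset.card_insert_of_notMem fun h => (hout v h).2.1 rfl⟩
  rw [Finset.coe_insert]
  exact Set.Pairwise.insert hI fun x hx _ => ⟨(hout x hx).2.2, fun h => (hout x hx).2.2 h.symm⟩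

theorem IsClique.erase_subset_nbrIn {W Q : Finset V} (hQ : G.IsClique (Q : Set V)) (hQW : Q ⊆ W)
    {v : V} (hv : v ∈ Q) : Q.erase v ⊆ G.nbrIn W v := by
  intro w hw
  rw [Finset.mem_erase] at hw
  exact mem_nbrIn.2 ⟨hQW hw.2, hQ hv hw.2 hw.1.symm⟩

/-- A vertex of a clique that is not simplicial has a neighbour outside that clique. -/
theorem IsClique.card_le_card_nbrIn {W Q : Finset V} (hQ : G.IsClique (Q : Set V)) (hQW : Q ⊆ W)
    {v : V} (hv : v ∈ Q) (hs : ¬ G.IsSimplicialIn W v) : Q.card ≤ (G.nbrIn W v).card := by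
  by_contra! hlt
  have hsub := hQ.erase_subset_nbrIn hQW hv
  have heq : Q.erase v = G.nbrIn W v :=
    Finset.eq_of_subset_of_card_le hsub (by rw [Finset.card_erase_of_mem hv]; omega)
  refine hs ?_
  rw [IsSimplicialIn, ← heq, Finset.insert_erase hv]
  exact hQ

theorem sum_halfWeight_le {W Q : Finset V} (h : ∀ v ∈ Q, Q.card ≤ (G.nbrIn W v).card) :
    ∑ v ∈ Q, G.halfWeight W v ≤ Q.card / ((Q.card : ℝ) + 1 / 2) := by
  have := Finset.sum_le_card_nsmul Q (G.halfWeight W) (1 / ((Q.card : ℝ) + 1 / 2)) fun v hv =>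
    one_div_le_one_div_of_le (by positivity)
      (by have : (Q.card : ℝ) ≤ (G.nbrIn W v).card := by exact_mod_cast h v hv
          linarith)
  rwa [nsmul_eq_mul, mul_one_div] at this

/-- This makes the clique hypothesis automatic once no simplicial vertex is left. -/
theorem sum_halfWeight_le_one {W Q : Finset V} (hW : ∀ v ∈ W, ¬ G.IsSimplicialIn W v)
    (hQW : Q ⊆ W) (hQ : G.IsClique (Q : Set V)) : ∑ v ∈ Q, G.halfWeight W v ≤ 1 :=
  (sum_halfWeight_le fun v hv => hQ.card_le_card_nbrIn hQW hv (hW v (hQW hv))).trans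
    ((div_le_one (by positivity)).2 (by linarith))

/-- Deleting a vertex of maximum degree does not decrease the total weight `1 / (d + 1 / 2)`. -/
theorem sum_halfWeight_le_sum_erase {W : Finset V} {x : V} (hx : x ∈ W)
    (hmax : ∀ v ∈ W, (G.nbrIn W v).card ≤ (G.nbrIn W x).card) (hpos : 0 < (G.nbrIn W x).card) :
    ∑ v ∈ W, G.halfWeight W v ≤ ∑ v ∈ W.erase x, G.halfWeight (W.erase x) v := by
  set D : ℝ := ((G.nbrIn W x).card : ℝ) with hD
  have hD1 : 1 ≤ D := by rw [hD]; exact_mod_cast hpos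
  -- The gain `1/(d - 1/2) - 1/(d + 1/2)` of a neighbour of degree `d` is least at `d = D`, where it
  -- is `c`; the `D` neighbours together repay the weight of `x`.
  set c : ℝ := 1 / ((D - 1 / 2) * (D + 1 / 2)) with hc
  have hpt : ∀ v ∈ W.erase x,
      G.halfWeight W v + (if G.Adj x v then c else 0) ≤ G.halfWeight (W.erase x) v := by
    intro v hv
    split_ifs with h
    · have hxv : x ∈ G.nbrIn W v := mem_nbrIn.2 ⟨hx, h.symm⟩
      have herase : G.nbrIn (W.erase x) v = (G.nbrIn W v).erase x := by
        ext w; simp [and_assoc]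
      have hd : (((G.nbrIn (W.erase x) v).card : ℕ) : ℝ) = ((G.nbrIn W v).card : ℝ) - 1 := by
        rw [herase, Finset.cast_card_erase_of_mem hxv]
      have h1 : (1 : ℝ) ≤ (G.nbrIn W v).card := by
        exact_mod_cast Finset.card_pos.2 ⟨x, hxv⟩
      have h2 : ((G.nbrIn W v).card : ℝ) ≤ D := by
        rw [hD]; exact_mod_cast hmax v (Finset.mem_of_mem_erase hv)
      rw [halfWeight, halfWeight, hd]
      set d : ℝ := ((G.nbrIn W v).card : ℝ)
      have hdiff : 1 / (d - 1 + 1 / 2) - 1 / (d + 1 / 2) = 1 / ((d - 1 / 2) * (d + 1 / 2)) := by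
        have h3 : d - 1 / 2 ≠ 0 := by linarith
        have h4 : d + 1 / 2 ≠ 0 := by linarith
        rw [show d - 1 + 1 / 2 = d - 1 / 2 by ring, div_sub_div _ _ h3 h4]
        congr 1
        ring
      have hcle : c ≤ 1 / ((d - 1 / 2) * (d + 1 / 2)) :=
        one_div_le_one_div_of_le (mul_pos (by linarith) (by linarith))
          (mul_le_mul (by linarith) (by linarith) (by linarith) (by linarith))
      linarith
    · rw [add_zero]
      exact halfWeight_anti (Finset.erase_subset _ _) v
  have hsum := Finset.sum_le_sum hpt
  have hfilter : (W.erase x).filter (G.Adj x) = G.nbrIn W x := by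
    ext w
    simp only [Finset.mem_filter, Finset.mem_erase, mem_nbrIn]
    exact ⟨fun h => ⟨h.1.2, h.2⟩, fun h => ⟨⟨h.2.ne', h.1⟩, h.2⟩⟩
  rw [Finset.sum_add_distrib, ← Finset.sum_filter, hfilter, Finset.sum_const, nsmul_eq_mul,
    ← hD] at hsum
  have hgain : G.halfWeight W x ≤ D * c := by
    rw [halfWeight, ← hD, hc, mul_one_div, div_le_div_iff₀ (by linarith)
      (mul_pos (by linarith) (by linarith)), one_mul]
    exact mul_le_mul_of_nonneg_right (by linarith) (by linarith)
  rw [← Finset.add_sum_erase _ _ hx]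
  linarith

/-! ### Merging two non-adjacent vertices -/

section Fold

variable {W T : Finset V} {x y : V}

/-- A vertex that gains `x` as a neighbour was adjacent to `y`, which is absent from `T`; sending
`x` back to `y` is injective. -/
theorem card_nbrIn_fold_le (hT : T ⊆ W) (hy : y ∈ W) (hyT : y ∉ T) {z : V} (hz : z ≠ x) :
    ((G.fold x y).nbrIn T z).card ≤ (G.nbrIn W z).card := by
  refine Finset.card_le_card_of_injOn (fun b => if b = x ∧ ¬ G.Adj z x then y else b) ?_ ?_
  · intro b hb
    simp only [Finset.mem_coe, mem_nbrIn, fold] at hb ⊢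
    obtain ⟨hbT, -, h⟩ := hb
    split_ifs with hbx
    · obtain ⟨rfl, hn⟩ := hbx
      rcases h with h | h | h
      · exact absurd h hn
      · exact absurd h.1 hz
      · exact ⟨hy, h.2.symm⟩
    · refine ⟨hT hbT, ?_⟩
      rcases h with h | h | h
      · exact h
      · exact absurd h.1 hz
      · by_contra hn
        exact hbx ⟨h.1, h.1 ▸ hn⟩
  · intro a ha b hb hab
    have haT := (mem_nbrIn.1 ha).1
    have hbT := (mem_nbrIn.1 hb).1
    dsimp only at hab
    split_ifs at hab with h1 h2 h2
    · exact h1.1.trans h2.1.symm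
    · exact absurd (hab ▸ hbT) hyT
    · exact absurd (hab ▸ haT) hyT
    · exact hab

theorem card_nbrIn_fold_self_le (hT : T ⊆ W) :
    ((G.fold x y).nbrIn T x).card ≤ (G.nbrIn W x).card + (G.nbrIn W y).card := by
  refine (Finset.card_le_card ?_).trans (Finset.card_union_le _ _)
  intro b hb
  simp only [mem_nbrIn, fold, Finset.mem_union] at hb ⊢
  obtain ⟨hbT, hne, h | h | h⟩ := hb
  · exact Or.inl ⟨hT hbT, h⟩
  · exact Or.inr ⟨hT hbT, h.2⟩
  · exact absurd h.1.symm hne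

/-- The weight `1 / (d + 1 / 2)`, with `x` reweighted to `1 / (2 D + 1)`, sums to at most `1` over
cliques of the folded graph. -/
theorem sum_update_halfWeight_le_one (hW : ∀ v ∈ W, ¬ G.IsSimplicialIn W v)
    {D : ℕ} (hD : ∀ v ∈ W, (G.nbrIn W v).card ≤ D) (hT : T ⊆ W) (hy : y ∈ W) (hyT : y ∉ T)
    {Q : Finset V} (hQT : Q ⊆ T) (hQ : (G.fold x y).IsClique (Q : Set V)) :
    ∑ v ∈ Q, Function.update (G.halfWeight W) x (1 / (2 * (D : ℝ) + 1)) v ≤ 1 := by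
  by_cases hxQ : x ∈ Q
  · rw [Finset.sum_update_of_mem hxQ, ← Finset.erase_eq]
    -- Folding does not raise the degree of `v ≠ x`, so the `|Q| - 1` other members of `Q` bound its
    -- degree in `W` from below.
    have hle : ∀ v ∈ Q.erase x, (Q.erase x).card ≤ (G.nbrIn W v).card := by
      intro v hv
      rw [Finset.mem_erase] at hv
      refine le_trans ?_ (card_nbrIn_fold_le (x := x) hT hy hyT hv.1)
      refine le_trans ?_ (Finset.card_le_card (hQ.erase_subset_nbrIn hQT hv.2))
      rw [Finset.card_erase_of_mem hxQ, Finset.card_erase_of_mem hv.2]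
    have hcard : (Q.erase x).card ≤ D := by
      rcases (Q.erase x).eq_empty_or_nonempty with h | ⟨v, hv⟩
      · simp [h]
      · exact (hle v hv).trans (hD v (hT (hQT (Finset.mem_of_mem_erase hv))))
    have hcard' : ((Q.erase x).card : ℝ) ≤ D := by exact_mod_cast hcard
    have hsum := sum_halfWeight_le hle
    have hle' : ((Q.erase x).card : ℝ) / ((Q.erase x).card + 1 / 2) ≤ D / (D + 1 / 2) := by
      rw [div_le_div_iff₀ (by positivity) (by positivity)]
      linarith
    -- Equality: `1 / (2D + 1)` is exactly the room that the bound on the rest of the clique leaves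
    -- for `x`.
    have heq : 1 / (2 * (D : ℝ) + 1) + D / (D + 1 / 2) = 1 := by
      field_simp
      ring
    linarith
  · rw [Finset.sum_update_of_notMem hxQ]
    refine sum_halfWeight_le_one hW (hQT.trans hT) fun a ha b hb hab => ?_
    rcases (hQ ha hb hab).2 with h | h | h
    · exact h
    · exact absurd (h.1 ▸ ha) hxQ
    · exact absurd (h.1 ▸ hb) hxQ

/-- If `u` is adjacent to the non-adjacent vertices `x` and `y`, then an independent set of the
graph in which the closed neighbourhood of `u` is replaced by the fold of `x` and `y` yields an
independent set with one more vertex. -/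
theorem exists_isIndepSet_of_fold {u : V} (hu : u ∈ W) (hx : x ∈ W) (hy : y ∈ G.nbrIn W u)
    (hxy : ¬ G.Adj x y) (hne : y ≠ x) {I : Finset V}
    (hIW : I ⊆ insert x (W \ insert u (G.nbrIn W u)))
    (hI : (G.fold x y).IsIndepSet (I : Set V)) :
    ∃ J ⊆ W, G.IsIndepSet (J : Set V) ∧ J.card = I.card + 1 := by
  have hIG : G.IsIndepSet (I : Set V) := fun a ha b hb hab h =>
    hI ha hb hab ⟨hab, Or.inl h⟩
  by_cases hxI : x ∈ I
  · have hyI : y ∉ I := by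
      intro h
      have := hIW h
      simp only [Finset.mem_insert, hne, Finset.mem_sdiff, hy, or_true, not_true_eq_false,
        and_false, or_self] at this
    have hadj : ∀ b ∈ I, ¬ G.Adj y b := by
      intro b hb h
      rcases eq_or_ne b x with rfl | hbx
      · exact hxy h.symm
      · exact hI hxI hb hbx.symm ⟨hbx.symm, Or.inr (Or.inl ⟨rfl, h⟩)⟩
    refine ⟨insert y I, Finset.insert_subset (mem_nbrIn.1 hy).1
      (hIW.trans (Finset.insert_subset hx Finset.sdiff_subset)), ?_,
      Finset.card_insert_of_notMem hyI⟩
    rw [Finset.coe_insert]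
    exact Set.Pairwise.insert hIG fun b hb _ => ⟨hadj b hb, fun h => hadj b hb h.symm⟩
  · exact exists_isIndepSet_insert hu ((Finset.subset_insert_iff_of_notMem hxI).1 hIW) hIG

end Fold

/-- If all vertices of a closed neighbourhood except for `x` form a clique without simplicial
vertices, then its weight is at most `1 + 1 / (2 D + 1)`, where `D` is the degree of `x`. -/
theorem sum_closedNbhd_le {W : Finset V} (hW : ∀ v ∈ W, ¬ G.IsSimplicialIn W v) {u x : V}
    (hu : u ∈ W) (hx : x ∈ G.nbrIn W u) (hle : (G.nbrIn W u).card ≤ (G.nbrIn W x).card)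
    (hclique : G.IsClique ((insert u (G.nbrIn W u)).erase x : Finset V)) :
    ∑ v ∈ insert u (G.nbrIn W u), G.halfWeight W v
      ≤ 1 + 1 / (2 * ((G.nbrIn W x).card : ℝ) + 1) := by
  have hxN : x ∈ insert u (G.nbrIn W u) := Finset.mem_insert_of_mem hx
  have hsub : (insert u (G.nbrIn W u)).erase x ⊆ W :=
    (Finset.erase_subset _ _).trans (insert_nbrIn_subset hu)
  have hsum := sum_halfWeight_le (G := G) (W := W) fun v hv =>
    hclique.card_le_card_nbrIn hsub hv (hW v (hsub hv))
  rw [Finset.card_erase_of_mem hxN, card_insert_nbrIn, Nat.add_sub_cancel] at hsum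
  rw [← Finset.add_sum_erase _ _ hxN, halfWeight]
  have hle' : ((G.nbrIn W u).card : ℝ) ≤ (G.nbrIn W x).card := by exact_mod_cast hle
  set D : ℝ := ((G.nbrIn W x).card : ℝ)
  have hD0 : 0 ≤ D := by positivity
  have h1 : ((G.nbrIn W u).card : ℝ) / ((G.nbrIn W u).card + 1 / 2) ≤ D / (D + 1 / 2) := by
    rw [div_le_div_iff₀ (by positivity) (by positivity)]
    linarith
  have h2 : 1 / (D + 1 / 2) + D / (D + 1 / 2) = 1 + 1 / (2 * D + 1) := by
    field_simp
    ring
  linarith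

/-! ### The induction -/

theorem exists_isIndepSet_sum_le (n : ℕ) (G : SimpleGraph V) (f : V → ℝ) (W : Finset V)
    (hn : W.card = n) (hf : ∀ v ∈ W, f v ≤ G.halfWeight W v)
    (hclique : ∀ K ⊆ W, G.IsClique (K : Set V) → ∑ v ∈ K, f v ≤ 1) :
    ∃ I ⊆ W, G.IsIndepSet (I : Set V) ∧ ∑ v ∈ W, f v ≤ I.card := by
  induction n using Nat.strong_induction_on generalizing G f W with
  | _ n ih =>
  subst hn
  rcases W.eq_empty_or_nonempty with rfl | hne
  · exact ⟨∅, by simp, by simp [IsIndepSet], by simp⟩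
  by_cases hW : ∀ v ∈ W, ¬ G.IsSimplicialIn W v
  · have hfsum := Finset.sum_le_sum hf
    obtain ⟨x, hx, hmax⟩ := Finset.exists_max_image W (fun v => (G.nbrIn W v).card) hne
    by_cases hE : ∀ v ∈ W.erase x, ¬ G.IsSimplicialIn (W.erase x) v
    · have hpos : 0 < (G.nbrIn W x).card := by
        rw [Finset.card_pos, Finset.nonempty_iff_ne_empty]
        intro h
        exact hW x hx (by simp [IsSimplicialIn, h])
      obtain ⟨I, hIW, hI, hIc⟩ := ih _ (Finset.card_erase_lt_of_mem hx) G
        (G.halfWeight (W.erase x)) (W.erase x) rfl (fun v _ => le_rfl)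
        fun K hK hKc => sum_halfWeight_le_one hE hK hKc
      exact ⟨I, hIW.trans (Finset.erase_subset _ _), hI,
        (hfsum.trans (sum_halfWeight_le_sum_erase hx hmax hpos)).trans hIc⟩
    · push Not at hE
      obtain ⟨u, hu, hus⟩ := hE
      rw [Finset.mem_erase] at hu
      have hNe : insert u (G.nbrIn (W.erase x) u) = (insert u (G.nbrIn W u)).erase x := by
        ext w
        simp only [Finset.mem_insert, mem_nbrIn, Finset.mem_erase]
        constructor
        · rintro (rfl | h)
          · exact ⟨hu.1, Or.inl rfl⟩
          · exact ⟨h.1.1, Or.inr ⟨h.1.2, h.2⟩⟩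
        · rintro ⟨h, rfl | h'⟩
          · exact Or.inl rfl
          · exact Or.inr ⟨⟨h, h'.1⟩, h'.2⟩
      rw [IsSimplicialIn, hNe] at hus
      have hxN : x ∈ insert u (G.nbrIn W u) := by
        by_contra h
        rw [Finset.erase_eq_of_notMem h] at hus
        exact hW u hu.2 hus
      have hxu : x ∈ G.nbrIn W u := (Finset.mem_insert.1 hxN).resolve_left hu.1.symm
      -- Otherwise `x` would complete the clique and `u` would be simplicial in `W`.
      obtain ⟨y, hy, hyx, hxy⟩ : ∃ y ∈ G.nbrIn W u, y ≠ x ∧ ¬ G.Adj x y := by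
        by_contra! h
        refine hW u hu.2 ?_
        rw [IsSimplicialIn, ← Finset.insert_erase hxN, Finset.coe_insert, isClique_insert]
        refine ⟨hus, fun b hb hxb => ?_⟩
        rw [Finset.mem_coe, Finset.mem_erase, Finset.mem_insert] at hb
        rcases hb.2 with rfl | hb'
        · exact (mem_nbrIn.1 hxu).2.symm
        · exact h b hb' hb.1
      set N := insert u (G.nbrIn W u) with hN
      have hNW : N ⊆ W := insert_nbrIn_subset hu.2
      have hyN : y ∈ N := Finset.mem_insert_of_mem hy
      have hyW := hNW hyN
      have hxT : x ∉ W \ N := by simp [hxN]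
      have hyT : y ∉ insert x (W \ N) := by simp [hyx, hyN]
      have huT : u ∉ insert x (W \ N) := by simp [hu.1, hN]
      have hTW : insert x (W \ N) ⊆ W := Finset.insert_subset hx Finset.sdiff_subset
      obtain ⟨I, hIT, hI, hIc⟩ := ih _
        (Finset.card_lt_card ((Finset.ssubset_iff_of_subset hTW).2 ⟨u, hu.2, huT⟩)) (G.fold x y)
        (Function.update (G.halfWeight W) x (1 / (2 * ((G.nbrIn W x).card : ℝ) + 1)))
        (insert x (W \ N)) rfl
        (by
          intro v hv
          rcases eq_or_ne v x with rfl | hvx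
          · rw [Function.update_self]
            refine one_div_le_one_div_of_le (by positivity) ?_
            -- The merged vertex has degree at most `2D`, and `1/(2D + 1) ≤ 1/(2D + 1/2)`.
            have h1 := (card_nbrIn_fold_self_le (G := G) (x := v) (y := y) hTW).trans
              (Nat.add_le_add_left (hmax y hyW) _)
            have h2 : (((G.fold v y).nbrIn (insert v (W \ N)) v).card : ℝ)
                ≤ (G.nbrIn W v).card + (G.nbrIn W v).card := by exact_mod_cast h1
            linarith
          · rw [Function.update_of_ne hvx]
            refine one_div_le_one_div_of_le (by positivity) ?_
            have h1 : (((G.fold x y).nbrIn (insert x (W \ N)) v).card : ℝ)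
                ≤ (G.nbrIn W v).card := by
              exact_mod_cast card_nbrIn_fold_le hTW hyW hyT hvx
            linarith)
        fun K hK hKc => sum_update_halfWeight_le_one hW hmax hTW hyW hyT hK hKc
      obtain ⟨J, hJW, hJ, hJc⟩ := exists_isIndepSet_of_fold hu.2 hx hy hxy hyx hIT hI
      refine ⟨J, hJW, hJ, hfsum.trans ?_⟩
      have hNsum := sum_closedNbhd_le hW hu.2 hxu (hmax u hu.2) hus
      rw [Finset.sum_insert hxT, Function.update_self, Finset.sum_update_of_notMem hxT] at hIc
      -- Of the weight `1 + 1/(2D + 1)` allowed to `N`, the merged vertex keeps `1/(2D + 1)` and the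
      -- extra vertex of `J` pays for the 1.
      rw [← Finset.sum_sdiff hNW, hJc]
      push_cast
      linarith
  · push Not at hW
    obtain ⟨u, hu, hus⟩ := hW
    have hNW := insert_nbrIn_subset (G := G) hu
    have hlt : W \ insert u (G.nbrIn W u) ⊂ W :=
      Finset.sdiff_ssubset hNW ⟨u, Finset.mem_insert_self _ _⟩
    obtain ⟨I, hIW, hI, hIc⟩ := ih _ (Finset.card_lt_card hlt) G f _ rfl
      (fun v hv => (hf v (hlt.1 hv)).trans (halfWeight_anti hlt.1 v))
      fun K hK => hclique K (hK.trans hlt.1)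
    obtain ⟨J, hJW, hJ, hJc⟩ := exists_isIndepSet_insert hu hIW hI
    refine ⟨J, hJW, hJ, ?_⟩
    rw [← Finset.sum_sdiff hNW, hJc, Nat.cast_succ]
    exact add_le_add hIc (hclique _ hNW hus)

end

end SimpleGraph

theorem mainTheorem1 {V : Type*} [Fintype V] (G : SimpleGraph V) [DecidableRel G.Adj]
    (f : V → ℝ)
    (hdeg : ∀ v : V, f v ≤ 1 / ((G.degree v : ℝ) + 1 / 2))
    (hclique : ∀ K : Finset V, G.IsClique (K : Set V) → ∑ v ∈ K, f v ≤ 1) :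
    (G.indepNum : ℝ) ≥ ∑ v : V, f v := by
  have hweight : ∀ v, G.halfWeight Finset.univ v = 1 / ((G.degree v : ℝ) + 1 / 2) := by
    intro v
    rw [SimpleGraph.halfWeight, SimpleGraph.nbrIn, ← SimpleGraph.card_neighborFinset_eq_degree,
      SimpleGraph.neighborFinset_eq_filter]
    congr
  obtain ⟨I, -, hI, hle⟩ := SimpleGraph.exists_isIndepSet_sum_le _ G f Finset.univ rfl
    (fun v _ => (hdeg v).trans (hweight v).ge) fun K _ => hclique K
  exact hle.trans (by exact_mod_cast hI.card_le_indepNum)
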